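/- Let $n\in\mathbb N$, let $\Omega\subset\mathbb R^n$ be open (for instance a bounded domain with Lipschitz boundary), and let $T>0$, $\alpha\in(0,1)$, $\nu>0$. Let $B=(B_{ij}^{kl})_{1\le i,j,k,l\le n}$ be a real-valued measurable tensor field on $\Omega$ such that for a.e. $x\in\Omega$ $$B_{ij}^{kl}=B_{ji}^{kl}=B_{ij}^{lk}=B_{kl}^{ij}\quad(1\le i,j,k,l\le n),$$ $$\nu\sum_{i,j}\eta_{ij}^2\le\sum_{i,j,k,l}B_{ij}^{kl}(x)\,\eta_{ij}\eta_{kl}\le\frac1\nu\sum_{i,j}\eta_{ij}^2\quad\text{for all symmetric }\eta\in\mathbb R^{n\times n}.$$ Let $\mathbf L^2(\Omega)=L^2(\Omega;\mathbb R^n)$ and let $\mathbf H_0^1(\Omega)$ be the closure of $C_c^\infty(\Omega;\mathbb R^n)$ in the $H^1$ norm. For fields $v_1,\dots,v_n,w_1,\dots,w_n\in\mathbf L^2(\Omega)$ write, with summation over $i,j$, $$(B_{ij}v_j,w_i):=\int_\Omega\sum_{i,j,k,l}B_{ik}^{jl}(x)\,(v_j)_l(x)\,(w_i)_k(x)\,dx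 ,$$ that is, $B_{ij}$ acts on vectors as the matrix with $(k,l)$ entry $B_{ik}^{jl}$, so that $(B_{ij}\partial_ju,\partial_iu)$ is the integral of the quadratic form of $B$ at the gradient matrix $(\partial_iu_k)_{ik}$. For $f\in L^2(0,T;\mathbf L^2(\Omega))$ let $${}_0I_s^{1-\alpha}f(s)=\frac1{\Gamma(1-\alpha)}\int_0^s(s-r)^{-\alpha}f(r)\,dr$$ be the Riemann–Liouville fractional integral (a Bochner integral). Then for every $u\in L^2(0,T;\mathbf H_0^1(\Omega))$ the following hold. For a.e. $s\in(0,T)$ the integrals that define ${}_0I_s^{1-\alpha}\partial_ju(s)$, $j=1,\dots,n$, and $\big(B_{ij}\,{}_0I_s^{1-\alpha}\partial_ju(s),\partial_iu(s)\big)$ converge absolutely. For every $t\in[0,T]$ the function $s\mapsto\big(B_{ij}\,{}_0I_s^{1-\alpha}\partial_ju(s),\partial_iu(s)\big)$ is integrable on $(0,t)$, and $$\int_0^t\big(B_{ij}\,{}_0I_s^{1-\alpha}\partial_ju,\partial_iu\big)\,ds\ \ge\ 0 .$$ -/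

import Mathlib

open MeasureTheory Set
open scoped ENNReal ContDiff

noncomputable section

namespace FracVisc

variable {n : ℕ}

/-- The Euclidean space `ℝⁿ`. -/
abbrev Rn (n : ℕ) : Type := EuclideanSpace ℝ (Fin n)

/-- The real Hilbert space `L²(Ω; ℝⁿ)` of square integrable vector fields, with inner product
`(u, v) = ∑ₖ ∫_Ω uₖ vₖ dx`. -/
abbrev L2Field (Ω : Set (Rn n)) : Type :=
  Lp (Rn n) 2 ((volume : Measure (Rn n)).restrict Ω)

/-- Pairs (field, its `n` first order partial derivatives), with the Hilbert norm
`‖(u, (g_j))‖² = ‖u‖² + ∑ⱼ ‖g_j‖²`, which is the `H¹` norm when `g_j = ∂_j u`. -/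
abbrev Jet (Ω : Set (Rn n)) : Type :=
  WithLp 2 (L2Field Ω × PiLp 2 (fun _ : Fin n => L2Field Ω))

/-- The `j`-th classical partial derivative of a vector field. -/
def classicalPartial (j : Fin n) (φ : Rn n → Rn n) (x : Rn n) : Rn n :=
  fderiv ℝ φ x (EuclideanSpace.single j 1)

/-- The pairs `(φ, (∂_j φ)_j)` with `φ ∈ C_c^∞(Ω; ℝⁿ)`. -/
def testJets (Ω : Set (Rn n)) : Submodule ℝ (Jet Ω) where
  carrier := {p | ∃ φ : Rn n → Rn n,
    ContDiff ℝ ∞ φ ∧ HasCompactSupport φ ∧ tsupport φ ⊆ Ω ∧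
    p.fst =ᵐ[volume.restrict Ω] φ ∧
    ∀ j : Fin n, p.snd j =ᵐ[volume.restrict Ω] classicalPartial j φ}
  zero_mem' := by
    refine ⟨0, contDiff_const, HasCompactSupport.zero, by simp, ?_, fun j => ?_⟩
    · exact Lp.coeFn_zero _ _ _
    · refine (Lp.coeFn_zero _ _ _).trans (Filter.Eventually.of_forall fun x => ?_)
      simp [classicalPartial]
  add_mem' := by
    rintro p q ⟨φ, hφ, cφ, sφ, pφ, dφ⟩ ⟨ψ, hψ, cψ, sψ, qψ, dψ⟩
    refine ⟨φ + ψ, hφ.add hψ, cφ.add cψ,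
      (tsupport_add φ ψ).trans (union_subset sφ sψ), ?_, fun j => ?_⟩
    · filter_upwards [Lp.coeFn_add p.fst q.fst, pφ, qψ] with x h1 h2 h3
      simpa [h2, h3] using h1
    · filter_upwards [Lp.coeFn_add (p.snd j) (q.snd j), dφ j, dψ j] with x h1 h2 h3
      have h4 : classicalPartial j (φ + ψ) x = classicalPartial j φ x + classicalPartial j ψ x := by
        unfold classicalPartial
        rw [fderiv_add (hφ.differentiable (by simp) x) (hψ.differentiable (by simp) x)]
        rfl
      rw [h4, ← h2, ← h3]
      exact h1
  smul_mem' := by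
    rintro c p ⟨φ, hφ, cφ, sφ, pφ, dφ⟩
    refine ⟨c • φ, contDiff_const.smul hφ, cφ.smul_left (f := fun _ => c),
      (tsupport_smul_subset_right (fun _ => c) φ).trans sφ, ?_, fun j => ?_⟩
    · filter_upwards [Lp.coeFn_smul c p.fst, pφ] with x h1 h2
      simpa [h2] using h1
    · filter_upwards [Lp.coeFn_smul c (p.snd j), dφ j] with x h1 h2
      have h4 : classicalPartial j (c • φ) x = c • classicalPartial j φ x := by
        unfold classicalPartial
        rw [fderiv_const_smul (hφ.differentiable (by simp) x)]
        rfl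
      rw [h4, ← h2]
      exact h1

/-- The Sobolev space `H₀¹(Ω; ℝⁿ)`: the closure of `C_c^∞(Ω; ℝⁿ)` for the `H¹` norm. A field `u` is
stored together with its partial derivatives, as the pair `(u, (∂_j u)_j)`. -/
def H01 (Ω : Set (Rn n)) : Submodule ℝ (Jet Ω) := (testJets Ω).topologicalClosure

/-- The weak partial derivative `∂_j : H₀¹(Ω; ℝⁿ) → L²(Ω; ℝⁿ)`. -/
def weakPartial {Ω : Set (Rn n)} (j : Fin n) (u : H01 Ω) : L2Field Ω := (u : Jet Ω).snd j

/-- The Bochner space `L²(0,T; H)`. -/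
abbrev TimeL2 (T : ℝ) (H : Type*) [NormedAddCommGroup H] : Type _ :=
  Lp H 2 ((volume : Measure ℝ).restrict (Ioo 0 T))

/-- The left-sided Riemann-Liouville fractional integral of order `β > 0` with base point `0`,
`₀I_t^β f (t) = Γ(β)⁻¹ ∫₀ᵗ (t - s)^(β-1) f(s) ds`, for a function with values in a Banach space. -/
def fracIntegral {H : Type*} [NormedAddCommGroup H] [NormedSpace ℝ H]
    (β : ℝ) (f : ℝ → H) (t : ℝ) : H :=
  (Real.Gamma β)⁻¹ • ∫ s in (0 : ℝ)..t, (t - s) ^ (β - 1) • f s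

/-- The components `B i j k l x = B_{ij}^{kl}(x)` form a measurable tensor field on `Ω` with the
symmetries `B_{ij}^{kl} = B_{ji}^{kl} = B_{ij}^{lk} = B_{kl}^{ij}`, which is uniformly elliptic on
symmetric matrices with constant `ν`. -/
structure IsEllipticTensor (Ω : Set (Rn n)) (ν : ℝ)
    (B : Fin n → Fin n → Fin n → Fin n → Rn n → ℝ) : Prop where
  aemeasurable : ∀ i j k l, AEMeasurable (B i j k l) (volume.restrict Ω)
  symmetric : ∀ᵐ x ∂(volume.restrict Ω), ∀ i j k l,
    B i j k l x = B j i k l x ∧ B i j k l x = B i j l k x ∧ B i j k l x = B k l i j x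
  elliptic : ∀ᵐ x ∂(volume.restrict Ω), ∀ η : Matrix (Fin n) (Fin n) ℝ, η.IsSymm →
    ν * ∑ i, ∑ j, η i j ^ 2 ≤ ∑ i, ∑ j, ∑ k, ∑ l, B i j k l x * η i j * η k l ∧
    ∑ i, ∑ j, ∑ k, ∑ l, B i j k l x * η i j * η k l ≤ 1 / ν * ∑ i, ∑ j, η i j ^ 2

/-- The matrix `B_{ij}(x)` that acts on the vector `∂_j u`. Its `(k,l)` entry couples `∂_j u_l` with
`∂_i u_k`, so it is the tensor component with index pairs `(i,k)` and `(j,l)`; with this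
convention `∑ᵢⱼ B_{ij} ∂_j u · ∂_i u` is the quadratic form of the tensor at the matrix
`(∂_i u_k)_{ik}`. -/
def block (B : Fin n → Fin n → Fin n → Fin n → Rn n → ℝ) (i j : Fin n) (x : Rn n) :
    Matrix (Fin n) (Fin n) ℝ :=
  Matrix.of fun k l => B i k j l x

/-- The density `∑ᵢⱼ B_{ij}(x) v_j(x) · w_i(x)`. -/
def viscousDensity {Ω : Set (Rn n)} (B : Fin n → Fin n → Fin n → Fin n → Rn n → ℝ)
    (v w : Fin n → L2Field Ω) (x : Rn n) : ℝ :=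
  ∑ i, ∑ j, ∑ k, (Matrix.mulVec (block B i j x) (fun l => v j x l)) k * w i x k

/-- The pairing `(B_{ij} v_j, w_i)`, summed over `i, j`, in `L²(Ω; ℝⁿ)`. -/
def viscousForm {Ω : Set (Rn n)} (B : Fin n → Fin n → Fin n → Fin n → Rn n → ℝ)
    (v w : Fin n → L2Field Ω) : ℝ :=
  ∫ x in Ω, viscousDensity B v w x

end FracVisc

end

open FracVisc

/-!
The proof separates time from space.

In space, the symmetries of the tensor let it see only the symmetric part of a matrix, so
ellipticity makes its quadratic form nonnegative on all matrices
(`FracVisc.tensorForm_self_nonneg`), and polarization bounds its components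
(`FracVisc.abs_le_of_tensorForm_le`). Hence `(v, w) ↦ (B_{ij} v_j, w_i)` is a bounded, symmetric,
positive semidefinite bilinear form `Q` on the Banach space `L²(Ω; ℝⁿ)ⁿ`
(`FracVisc.viscousFormL`). The gradient is a bounded operator from `H₀¹` into that space, so it
remains to show, for `f ∈ L²(0,t; H)` with values in a Banach space `H` carrying such a form,
that `∫₀ᵗ ∫₀ˢ (s - r)^(-α) Q(f(r), f(s)) dr ds ≥ 0`.

In time, the symmetry of `Q` turns this double integral into half of the integral of
`|s - r|^(-α) Q(f(r), f(s))` over the square `(0,t)²`. The Riesz kernel has the Gram representation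
`|s - r|^(-α) = C⁻¹ ∫ (z - s)₊^(-β) (z - r)₊^(-β) dz`, `2β = 1 + α` (`exists_gram_powKernel`), so
Fubini's theorem gives `C⁻¹ ∫ Q(F_z, F_z) dz` with `F_z = ∫ (z - s)₊^(-β) f(s) ds`, and this is
nonnegative (`integral_powKernel_mul_bilin_nonneg`). Absolute convergence everywhere follows from
`2 ‖f(r)‖ ‖f(s)‖ ≤ ‖f(r)‖² + ‖f(s)‖²` and the local integrability of the kernel
(`integrable_powKernel_mul_norm_mul_norm`).
-/

/-! ### The one-sided power kernel -/

/-- The one-sided power kernel `x ↦ x₊^(-γ)`; it vanishes for `x ≤ 0`, also at `x = 0`. -/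
noncomputable def powKernel (γ x : ℝ) : ℝ := (Ioi (0 : ℝ)).indicator (fun y => y ^ (-γ)) x

lemma powKernel_of_pos {γ x : ℝ} (hx : 0 < x) : powKernel γ x = x ^ (-γ) :=
  indicator_of_mem (s := Ioi (0 : ℝ)) hx _

lemma powKernel_of_nonpos {γ x : ℝ} (hx : x ≤ 0) : powKernel γ x = 0 :=
  indicator_of_notMem (s := Ioi (0 : ℝ)) (by simpa using hx) _

lemma powKernel_nonneg (γ x : ℝ) : 0 ≤ powKernel γ x :=
  indicator_nonneg (fun _ hy => Real.rpow_nonneg (le_of_lt hy) _) x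

lemma measurable_powKernel (γ : ℝ) : Measurable (powKernel γ) :=
  (measurable_id.pow_const _).indicator measurableSet_Ioi

lemma integrable_indicator_powKernel {γ : ℝ} (hγ : γ < 1) (t : ℝ) :
    Integrable ((Iio t).indicator (powKernel γ)) := by
  have h : IntegrableOn (fun y : ℝ => y ^ (-γ)) (Ioc 0 (max t 0)) :=
    (intervalIntegrable_iff_integrableOn_Ioc_of_le (le_max_right t 0)).1
      (intervalIntegral.intervalIntegrable_rpow' (by linarith))
  have h' : IntegrableOn (fun y : ℝ => y ^ (-γ)) (Iio t ∩ Ioi 0) :=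
    h.mono_set fun y hy => ⟨hy.2, (le_of_lt hy.1).trans (le_max_left _ _)⟩
  rw [← integrable_indicator_iff (measurableSet_Iio.inter measurableSet_Ioi)] at h'
  rw [← indicator_indicator] at h'
  exact h'

/-- The integral of this profile is the constant in the Gram representation of `|x|^(1 - 2β)`. The
lower bound on `β` is needed at infinity, the upper bound at `0`. -/
lemma integrable_powKernel_mul_powKernel_add_one {β : ℝ} (h1 : 1 / 2 < β) (h2 : β < 1) :
    Integrable fun w => powKernel β w * powKernel β (w + 1) := by
  have hdom : Integrable (fun w => (Iio (2 : ℝ)).indicator (powKernel β) w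
      + (Ioi (1 : ℝ)).indicator (fun y => y ^ (-(2 * β))) w) := by
    refine (integrable_indicator_powKernel h2 2).add ?_
    rw [integrable_indicator_iff measurableSet_Ioi]
    exact integrableOn_Ioi_rpow_of_lt (by linarith) one_pos
  have hm := measurable_powKernel β
  refine hdom.mono' (by fun_prop) (Filter.Eventually.of_forall fun w => ?_)
  rw [Real.norm_of_nonneg (mul_nonneg (powKernel_nonneg _ _) (powKernel_nonneg _ _))]
  rcases le_or_gt w 0 with hw | hw
  · rw [powKernel_of_nonpos hw, zero_mul]
    exact add_nonneg (indicator_nonneg (fun _ _ => powKernel_nonneg _ _) _)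
      (indicator_nonneg (fun y hy => Real.rpow_nonneg (zero_le_one.trans (le_of_lt hy)) _) _)
  · have hw1 : (0 : ℝ) < w + 1 := by linarith
    rcases le_or_gt w 1 with h | h
    · rw [indicator_of_mem (by simp; linarith), indicator_of_notMem (by simpa using h), add_zero]
      refine mul_le_of_le_one_right (powKernel_nonneg _ _) ?_
      rw [powKernel_of_pos hw1]
      exact Real.rpow_le_one_of_one_le_of_nonpos (by linarith) (by linarith)
    · refine le_add_of_nonneg_of_le (indicator_nonneg (fun _ _ => powKernel_nonneg _ _) _) ?_
      rw [indicator_of_mem (by simpa using h), powKernel_of_pos hw, powKernel_of_pos hw1,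
        show -(2 * β) = -β + -β by ring, Real.rpow_add hw]
      exact mul_le_mul_of_nonneg_left (Real.rpow_le_rpow_of_nonpos hw (by linarith) (by linarith))
        (Real.rpow_nonneg hw.le _)

lemma powKernel_mul_left {γ d : ℝ} (hd : 0 < d) (x : ℝ) :
    powKernel γ (d * x) = d ^ (-γ) * powKernel γ x := by
  rcases le_or_gt x 0 with hx | hx
  · rw [powKernel_of_nonpos hx, powKernel_of_nonpos (mul_nonpos_of_nonneg_of_nonpos hd.le hx),
      mul_zero]
  · rw [powKernel_of_pos hx, powKernel_of_pos (mul_pos hd hx), Real.mul_rpow hd.le hx.le]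

/-- **Gram representation of the Riesz kernel.** For `s ≠ r` the kernel `|s - r|^(-α)` is, up to a
positive constant, the `L²` inner product of the one-sided kernels `(z - s)₊^(-β)` and
`(z - r)₊^(-β)` with `2β = 1 + α`. -/
lemma exists_gram_powKernel {α : ℝ} (hα : α ∈ Ioo (0 : ℝ) 1) :
    ∃ C : ℝ, 0 < C ∧ ∀ s r : ℝ, s ≠ r →
      Integrable (fun z => powKernel ((1 + α) / 2) (z - s) * powKernel ((1 + α) / 2) (z - r)) ∧
      ∫ z, powKernel ((1 + α) / 2) (z - s) * powKernel ((1 + α) / 2) (z - r)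
        = C * (powKernel α (s - r) + powKernel α (r - s)) := by
  obtain ⟨h0, h1⟩ := hα
  set β := (1 + α) / 2 with hβ
  have hH := integrable_powKernel_mul_powKernel_add_one (β := β) (by linarith) (by linarith)
  set H : ℝ → ℝ := fun w => powKernel β w * powKernel β (w + 1) with hHdef
  have key : ∀ s r : ℝ, s < r →
      Integrable (fun z => powKernel β (z - s) * powKernel β (z - r)) ∧
      ∫ z, powKernel β (z - s) * powKernel β (z - r)
        = (∫ w, H w) * (powKernel α (s - r) + powKernel α (r - s)) := by
    intro s r hsr
    have hd : 0 < r - s := sub_pos.2 hsr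
    -- the substitution `z = r + (r - s) w`
    have hF : (fun z => powKernel β (z - s) * powKernel β (z - r))
        = fun z => ((r - s) ^ (-β) * (r - s) ^ (-β)) * H ((r - s)⁻¹ * (z - r)) := by
      funext z
      have e1 : z - r = (r - s) * ((r - s)⁻¹ * (z - r)) := by field_simp
      have e2 : z - s = (r - s) * ((r - s)⁻¹ * (z - r) + 1) := by field_simp; ring
      rw [e2]
      nth_rw 2 [e1]
      rw [powKernel_mul_left hd, powKernel_mul_left hd]
      ring
    rw [hF]
    refine ⟨((hH.comp_mul_left' (inv_ne_zero hd.ne')).comp_sub_right r).const_mul _, ?_⟩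
    rw [integral_const_mul, integral_sub_right_eq_self (fun z => H ((r - s)⁻¹ * z)) r,
      Measure.integral_comp_mul_left, powKernel_of_nonpos (by linarith : s - r ≤ 0), zero_add,
      powKernel_of_pos hd, inv_inv, abs_of_pos hd, smul_eq_mul, ← Real.rpow_add hd,
      ← mul_assoc, ← Real.rpow_add_one hd.ne', mul_comm]
    congr 2
    rw [hβ]; ring
  refine ⟨∫ w, H w, ?_, fun s r hsr => ?_⟩
  · refine (integral_pos_iff_support_of_nonneg
      (fun w => mul_nonneg (powKernel_nonneg _ _) (powKernel_nonneg _ _)) hH).2 ?_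
    refine lt_of_lt_of_le (b := volume (Ioi (0 : ℝ))) (by simp) (measure_mono fun w hw => ?_)
    have hw : (0 : ℝ) < w := hw
    simp only [Function.mem_support]
    rw [powKernel_of_pos hw, powKernel_of_pos (by linarith)]
    positivity
  · rcases lt_or_gt_of_ne hsr with h | h
    · exact key s r h
    · obtain ⟨ha, hb⟩ := key r s h
      simp only [mul_comm (powKernel β (_ - s)), add_comm (powKernel α (s - r))]
      exact ⟨ha, hb⟩

/-! ### Positivity of fractional integration for Banach space valued functions -/

section Positivity

variable {H : Type*} [NormedAddCommGroup H]

/-- The diagonal is negligible; there the Gram representation of the singular kernel fails. -/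
lemma ae_prod_ne (μ ν : Measure ℝ) [SFinite μ] [SFinite ν] [NullSingletonClass ν] :
    ∀ᵐ p : ℝ × ℝ ∂(μ.prod ν), p.1 ≠ p.2 := by
  have hms : MeasurableSet {p : ℝ × ℝ | p.1 ≠ p.2} :=
    (measurableSet_eq_fun measurable_fst measurable_snd).compl
  refine (Measure.ae_prod_iff_ae_ae hms).2 (Filter.Eventually.of_forall fun s => ?_)
  filter_upwards [measure_eq_zero_iff_ae_notMem.1 (measure_singleton (μ := ν) s)] with r hr h
  exact hr h.symm

lemma integrable_powKernel_mul_norm_mul_norm {γ : ℝ} (hγ : γ < 1) {t : ℝ} {f : ℝ → H}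
    (hf : MemLp f 2 (volume.restrict (Ioo 0 t))) :
    Integrable (fun p : ℝ × ℝ => powKernel γ (p.1 - p.2) * (‖f p.1‖ * ‖f p.2‖))
      ((volume.restrict (Ioo 0 t)).prod (volume.restrict (Ioo 0 t))) := by
  have hk := integrable_indicator_powKernel hγ t
  have hφ : Integrable ((Ioo 0 t).indicator fun r => ‖f r‖ ^ 2) := by
    rw [integrable_indicator_iff measurableSet_Ioo]
    exact hf.integrable_norm_pow (by norm_num)
  have h1 := hφ.convolution_integrand (ContinuousLinearMap.mul ℝ ℝ) hk
  have h2 := (hφ.convolution_integrand (ContinuousLinearMap.mul ℝ ℝ) hk.comp_neg).swap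
  have h3 := (h1.add h2).integrableOn (s := Ioo 0 t ×ˢ Ioo 0 t)
  rw [Measure.prod_restrict]
  have hfm : AEStronglyMeasurable (fun p : ℝ × ℝ => ‖f p.1‖ * ‖f p.2‖)
      ((volume.prod volume).restrict (Ioo 0 t ×ˢ Ioo 0 t)) := by
    rw [← Measure.prod_restrict]
    exact hf.1.norm.comp_fst.mul hf.1.norm.comp_snd
  have hm := measurable_powKernel γ
  refine h3.mono' ((by fun_prop : Measurable fun p : ℝ × ℝ =>
    powKernel γ (p.1 - p.2)).aestronglyMeasurable.mul hfm) ?_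
  filter_upwards [ae_restrict_mem (measurableSet_Ioo.prod measurableSet_Ioo)] with p hp
  obtain ⟨⟨a1, a2⟩, b1, b2⟩ := hp
  have hlt : p.1 - p.2 < t := by linarith
  simp only [Pi.add_apply, Function.comp, ContinuousLinearMap.mul_apply', Prod.fst_swap,
    Prod.snd_swap, neg_sub]
  rw [indicator_of_mem (show p.2 ∈ Ioo 0 t from ⟨b1, b2⟩),
    indicator_of_mem (show p.1 ∈ Ioo 0 t from ⟨a1, a2⟩),
    indicator_of_mem (show p.1 - p.2 ∈ Iio t from hlt),
    Real.norm_of_nonneg (mul_nonneg (powKernel_nonneg _ _) (by positivity))]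
  -- Young's inequality `2 ‖f s‖ ‖f r‖ ≤ ‖f s‖² + ‖f r‖²`
  nlinarith [powKernel_nonneg γ (p.1 - p.2), sq_nonneg (‖f p.1‖ - ‖f p.2‖),
    mul_nonneg (powKernel_nonneg γ (p.1 - p.2)) (sq_nonneg (‖f p.1‖ - ‖f p.2‖)),
    mul_nonneg (powKernel_nonneg γ (p.1 - p.2)) (sq_nonneg (‖f p.1‖)),
    mul_nonneg (powKernel_nonneg γ (p.1 - p.2)) (sq_nonneg (‖f p.2‖))]

variable [NormedSpace ℝ H]

lemma aestronglyMeasurable_bilin_prod {t : ℝ} {f : ℝ → H} (Q : H →L[ℝ] H →L[ℝ] ℝ)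
    (hf : AEStronglyMeasurable f (volume.restrict (Ioo 0 t))) :
    AEStronglyMeasurable (fun p : ℝ × ℝ => Q (f p.2) (f p.1))
      ((volume.restrict (Ioo 0 t)).prod (volume.restrict (Ioo 0 t))) :=
  Q.aestronglyMeasurable_comp₂ hf.comp_snd hf.comp_fst

lemma integrable_powKernel_mul_bilin {γ : ℝ} (hγ : γ < 1) {t : ℝ} {f : ℝ → H}
    (Q : H →L[ℝ] H →L[ℝ] ℝ) (hf : MemLp f 2 (volume.restrict (Ioo 0 t))) :
    Integrable (fun p : ℝ × ℝ => powKernel γ (p.1 - p.2) * Q (f p.2) (f p.1))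
      ((volume.restrict (Ioo 0 t)).prod (volume.restrict (Ioo 0 t))) := by
  have hm := measurable_powKernel γ
  refine ((integrable_powKernel_mul_norm_mul_norm hγ hf).const_mul ‖Q‖).mono'
    ((by fun_prop : Measurable fun p : ℝ × ℝ =>
      powKernel γ (p.1 - p.2)).aestronglyMeasurable.mul
        (aestronglyMeasurable_bilin_prod Q hf.1)) (Filter.Eventually.of_forall fun p => ?_)
  rw [norm_mul, Real.norm_of_nonneg (powKernel_nonneg _ _)]
  calc _ ≤ powKernel γ (p.1 - p.2) * (‖Q‖ * ‖f p.2‖ * ‖f p.1‖) := by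
        gcongr
        · exact powKernel_nonneg _ _
        · exact Q.le_opNorm₂ _ _
    _ = _ := by ring

/-- If `(a, b) ↦ h a * h b` is integrable, then so is `h`. -/
lemma integrable_of_integrable_prod_self {X : Type*} [MeasurableSpace X] {μ : Measure X} [SFinite μ]
    {h : X → ℝ} (hh : Integrable (fun p : X × X => h p.1 * h p.2) (μ.prod μ)) :
    Integrable h μ := by
  by_cases h0 : ∀ᵐ a ∂μ, h a = 0
  · exact (integrable_zero X ℝ μ).congr (h0.mono fun a ha => ha.symm)
  · obtain ⟨a, ha, ha0⟩ := ((Filter.not_eventually.1 h0).and_eventually hh.prod_right_ae).exists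
    exact (integrable_const_mul_iff (isUnit_iff_ne_zero.2 ha) h).1 ha0

/-- **Positivity.** The one-sided kernel is half of the symmetric kernel `|s - r|^(-γ)`, which by
the Gram representation turns the double integral into an integral over `z` of the values
`Q(F_z, F_z)` with `F_z = ∫ (z - s)₊^(-β) f(s) ds`. -/
theorem integral_powKernel_mul_bilin_nonneg [CompleteSpace H] {γ : ℝ} (hγ : γ ∈ Ioo (0 : ℝ) 1)
    {t : ℝ} {f : ℝ → H} (Q : H →L[ℝ] H →L[ℝ] ℝ) (hsymm : ∀ v w, Q v w = Q w v)
    (hpos : ∀ v, 0 ≤ Q v v) (hf : MemLp f 2 (volume.restrict (Ioo 0 t))) :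
    0 ≤ ∫ p : ℝ × ℝ, powKernel γ (p.1 - p.2) * Q (f p.2) (f p.1)
      ∂((volume.restrict (Ioo 0 t)).prod (volume.restrict (Ioo 0 t))) := by
  obtain ⟨C, hC, hgram⟩ := exists_gram_powKernel hγ
  set μ := volume.restrict (Ioo 0 t) with hμ
  set β := (1 + γ) / 2
  have hmγ := measurable_powKernel γ
  have hmβ := measurable_powKernel β
  -- if `q` is integrable against both one-sided kernels, then multiplying it by the Gram factors
  -- gives a function that is integrable in `(s, r, z)`, which is what Fubini's theorem requires
  have hint : ∀ q : ℝ × ℝ → ℝ, AEStronglyMeasurable q (μ.prod μ) →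
      Integrable (fun p : ℝ × ℝ => powKernel γ (p.1 - p.2) * q p) (μ.prod μ) →
      Integrable (fun p : ℝ × ℝ => powKernel γ (p.2 - p.1) * q p) (μ.prod μ) →
      Integrable (fun x : (ℝ × ℝ) × ℝ =>
        powKernel β (x.2 - x.1.1) * powKernel β (x.2 - x.1.2) * q x.1)
        ((μ.prod μ).prod volume) := by
    intro q hq h1 h2
    have hmeas : AEStronglyMeasurable (fun x : (ℝ × ℝ) × ℝ =>
        powKernel β (x.2 - x.1.1) * powKernel β (x.2 - x.1.2) * q x.1)
        ((μ.prod μ).prod volume) :=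
      (by fun_prop : Measurable fun x : (ℝ × ℝ) × ℝ =>
        powKernel β (x.2 - x.1.1) * powKernel β (x.2 - x.1.2)).aestronglyMeasurable.mul
        hq.comp_fst
    rw [integrable_prod_iff hmeas]
    constructor
    · filter_upwards [ae_prod_ne μ μ] with p hp
      exact (hgram p.1 p.2 hp).1.mul_const _
    · refine ((h1.add h2).norm.const_mul C).congr ?_
      filter_upwards [ae_prod_ne μ μ] with p hp
      simp only [norm_mul, Real.norm_of_nonneg (powKernel_nonneg _ _), Pi.add_apply]
      rw [integral_mul_const, (hgram p.1 p.2 hp).2, ← add_mul, norm_mul,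
        Real.norm_of_nonneg (add_nonneg (powKernel_nonneg _ _) (powKernel_nonneg _ _))]
      ring
  have hI := integrable_powKernel_mul_bilin hγ.2 Q hf
  have hI' : Integrable (fun p : ℝ × ℝ => powKernel γ (p.2 - p.1) * Q (f p.2) (f p.1))
      (μ.prod μ) :=
    hI.swap.congr (Filter.Eventually.of_forall fun p => by
      simp [Function.comp, hsymm (f p.1)])
  have hN := integrable_powKernel_mul_norm_mul_norm hγ.2 hf
  have hN' : Integrable (fun p : ℝ × ℝ => powKernel γ (p.2 - p.1) * (‖f p.1‖ * ‖f p.2‖))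
      (μ.prod μ) :=
    hN.swap.congr (Filter.Eventually.of_forall fun p => by
      simp [Function.comp, mul_comm ‖f p.1‖])
  have hQ3 := hint _ (aestronglyMeasurable_bilin_prod Q hf.1) hI hI'
  have hN3 := hint _ (hf.1.norm.comp_fst.mul hf.1.norm.comp_snd) hN hN'
  -- both halves of the square contribute equally, by the symmetry of `Q`
  have hswap : ∫ p : ℝ × ℝ, powKernel γ (p.2 - p.1) * Q (f p.2) (f p.1) ∂(μ.prod μ)
      = ∫ p : ℝ × ℝ, powKernel γ (p.1 - p.2) * Q (f p.2) (f p.1) ∂(μ.prod μ) := by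
    rw [← integral_prod_swap]
    exact integral_congr_ae (Filter.Eventually.of_forall fun p => by simp [hsymm (f p.1)])
  have hz : ∀ᵐ z : ℝ, 0 ≤ ∫ p : ℝ × ℝ,
      powKernel β (z - p.1) * powKernel β (z - p.2) * Q (f p.2) (f p.1) ∂(μ.prod μ) := by
    filter_upwards [hN3.prod_left_ae] with z hzi
    -- `F_z` is a convergent integral for almost every `z`; otherwise it would be the junk value `0`
    have hh : Integrable (fun s => powKernel β (z - s) * ‖f s‖) μ := by
      refine integrable_of_integrable_prod_self (hzi.congr
        (Filter.Eventually.of_forall fun p => ?_))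
      simp only [Pi.mul_apply]
      ring
    have hF : Integrable (fun s => powKernel β (z - s) • f s) μ := by
      refine hh.mono' ((by fun_prop : Measurable fun s : ℝ =>
        powKernel β (z - s)).aestronglyMeasurable.smul hf.1)
        (Filter.Eventually.of_forall fun s => ?_)
      rw [norm_smul, Real.norm_of_nonneg (powKernel_nonneg _ _)]
    have := integral_prod_bilin (μ := μ) (ν := μ) Q hF hF
    refine (hpos (∫ s, powKernel β (z - s) • f s ∂μ)).trans_eq (this.symm.trans ?_)
    refine integral_congr_ae (Filter.Eventually.of_forall fun p => ?_)
    simp only [map_smul, smul_apply, smul_eq_mul]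
    rw [hsymm (f p.1)]
    ring
  have hfub : ∫ p : ℝ × ℝ, (∫ z : ℝ,
        powKernel β (z - p.1) * powKernel β (z - p.2) * Q (f p.2) (f p.1)) ∂(μ.prod μ)
      = C * (2 * ∫ p : ℝ × ℝ, powKernel γ (p.1 - p.2) * Q (f p.2) (f p.1) ∂(μ.prod μ)) := by
    rw [two_mul]
    nth_rw 2 [← hswap]
    rw [← integral_add hI hI', ← integral_const_mul]
    refine integral_congr_ae ?_
    filter_upwards [ae_prod_ne μ μ] with p hp
    rw [integral_mul_const, (hgram p.1 p.2 hp).2]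
    ring
  have h0 := integral_nonneg_of_ae hz
  rw [← integral_integral_swap hQ3, hfub] at h0
  by_contra! hneg
  nlinarith

/-- The integrals that define the fractional integral of order `1 - γ` of an integrable function
converge absolutely almost everywhere. -/
lemma ae_intervalIntegrable_rpow_smul {γ : ℝ} (hγ : γ < 1) {t : ℝ} {f : ℝ → H}
    (hf : IntegrableOn f (Ioo 0 t)) :
    ∀ᵐ s ∂(volume.restrict (Ioo 0 t)),
      IntervalIntegrable (fun r => (s - r) ^ (-γ) • f r) volume 0 s := by
  have h := ((integrable_indicator_iff measurableSet_Ioo).2 hf).convolution_integrand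
    (ContinuousLinearMap.lsmul ℝ ℝ (E := H)).flip (integrable_indicator_powKernel hγ t)
  filter_upwards [ae_restrict_of_ae h.prod_right_ae, ae_restrict_mem measurableSet_Ioo]
    with s hs hst
  rw [intervalIntegrable_iff_integrableOn_Ioo_of_le hst.1.le]
  refine hs.integrableOn.congr_fun (fun r hr => ?_) measurableSet_Ioo
  have hlt : s - r < t := by linarith [hst.2, hr.1]
  simp only [ContinuousLinearMap.flip_apply, ContinuousLinearMap.lsmul_apply]
  rw [indicator_of_mem (show s - r ∈ Iio t from hlt),
    indicator_of_mem (show r ∈ Ioo 0 t from ⟨hr.1, hr.2.trans hst.2⟩),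
    powKernel_of_pos (sub_pos.2 hr.2)]

lemma bilin_intervalIntegral_rpow_smul [CompleteSpace H] {γ t s : ℝ} {f : ℝ → H}
    (Q : H →L[ℝ] H →L[ℝ] ℝ) (hs : s ∈ Ioo 0 t)
    (hf : IntervalIntegrable (fun r => (s - r) ^ (-γ) • f r) volume 0 s) :
    Q (∫ r in (0 : ℝ)..s, (s - r) ^ (-γ) • f r) (f s)
      = ∫ r in Ioo 0 t, powKernel γ (s - r) * Q (f r) (f s) := by
  have h1 : Q (∫ r in (0 : ℝ)..s, (s - r) ^ (-γ) • f r) (f s)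
      = ∫ r in (0 : ℝ)..s, Q.flip (f s) ((s - r) ^ (-γ) • f r) :=
    ((Q.flip (f s)).intervalIntegral_comp_comm hf).symm
  rw [h1, intervalIntegral.integral_of_le hs.1.le, ← integral_Ioc_eq_integral_Ioo]
  symm
  refine (setIntegral_eq_of_subset_of_forall_sdiff_eq_zero measurableSet_Ioc
    (Ioc_subset_Ioc_right hs.2.le) (fun r hr => ?_)).trans ?_
  · rw [powKernel_of_nonpos, zero_mul]
    by_contra! h
    exact hr.2 ⟨hr.1.1, by linarith⟩
  · rw [integral_Ioc_eq_integral_Ioo, integral_Ioc_eq_integral_Ioo]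
    refine setIntegral_congr_fun measurableSet_Ioo fun r hr => ?_
    simp [powKernel_of_pos (sub_pos.2 hr.2)]

/-- Integrability and positivity of `s ↦ Q(₀I^(1-γ) f(s), f(s))`. -/
theorem bilin_fracIntegral_nonneg [CompleteSpace H] {γ : ℝ} (hγ : γ ∈ Ioo (0 : ℝ) 1)
    {t : ℝ} (ht : 0 ≤ t) {f : ℝ → H} (Q : H →L[ℝ] H →L[ℝ] ℝ) (hsymm : ∀ v w, Q v w = Q w v)
    (hpos : ∀ v, 0 ≤ Q v v) (hf : MemLp f 2 (volume.restrict (Ioo 0 t))) :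
    IntervalIntegrable (fun s => Q (FracVisc.fracIntegral (1 - γ) f s) (f s)) volume 0 t ∧
      0 ≤ ∫ s in (0 : ℝ)..t, Q (FracVisc.fracIntegral (1 - γ) f s) (f s) := by
  have hI := integrable_powKernel_mul_bilin hγ.2 Q hf
  have hae : (fun s => (Real.Gamma (1 - γ))⁻¹ *
        ∫ r in Ioo 0 t, powKernel γ (s - r) * Q (f r) (f s))
      =ᵐ[volume.restrict (Ioo 0 t)] fun s => Q (FracVisc.fracIntegral (1 - γ) f s) (f s) := by
    filter_upwards [ae_intervalIntegrable_rpow_smul hγ.2 (hf.integrable (by norm_num)),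
      ae_restrict_mem measurableSet_Ioo] with s hs hst
    rw [← bilin_intervalIntegral_rpow_smul Q hst hs, FracVisc.fracIntegral,
      show 1 - γ - 1 = -γ by ring]
    simp
  refine ⟨?_, ?_⟩
  · rw [intervalIntegrable_iff_integrableOn_Ioo_of_le ht]
    exact (hI.integral_prod_left.const_mul _).congr hae
  · rw [intervalIntegral.integral_of_le ht, integral_Ioc_eq_integral_Ioo, ← integral_congr_ae hae,
      integral_const_mul]
    refine mul_nonneg (inv_nonneg.2 (Real.Gamma_pos_of_pos (by linarith [hγ.2])).le) ?_
    have := integral_powKernel_mul_bilin_nonneg hγ Q hsymm hpos hf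
    rwa [integral_prod _ hI] at this

end Positivity

namespace FracVisc

variable {n : ℕ}

/-! ### Elliptic tensors -/

/-- The bilinear form `∑ᵢⱼₖₗ A_{ij}^{kl} η_{ij} ζ_{kl}` of a tensor on matrices. -/
def tensorForm (A : Fin n → Fin n → Fin n → Fin n → ℝ) (η ζ : Matrix (Fin n) (Fin n) ℝ) : ℝ :=
  ∑ i, ∑ j, ∑ k, ∑ l, A i j k l * η i j * ζ k l

lemma tensorForm_add_left (A : Fin n → Fin n → Fin n → Fin n → ℝ)
    (η η' ζ : Matrix (Fin n) (Fin n) ℝ) :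
    tensorForm A (η + η') ζ = tensorForm A η ζ + tensorForm A η' ζ := by
  simp only [tensorForm, Matrix.add_apply, mul_add, add_mul, Finset.sum_add_distrib]

lemma tensorForm_add_right (A : Fin n → Fin n → Fin n → Fin n → ℝ)
    (η ζ ζ' : Matrix (Fin n) (Fin n) ℝ) :
    tensorForm A η (ζ + ζ') = tensorForm A η ζ + tensorForm A η ζ' := by
  simp only [tensorForm, Matrix.add_apply, mul_add, Finset.sum_add_distrib]

lemma tensorForm_neg_left (A : Fin n → Fin n → Fin n → Fin n → ℝ)
    (η ζ : Matrix (Fin n) (Fin n) ℝ) : tensorForm A (-η) ζ = -tensorForm A η ζ := by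
  simp only [tensorForm, Matrix.neg_apply, mul_neg, neg_mul, Finset.sum_neg_distrib]

lemma tensorForm_neg_right (A : Fin n → Fin n → Fin n → Fin n → ℝ)
    (η ζ : Matrix (Fin n) (Fin n) ℝ) : tensorForm A η (-ζ) = -tensorForm A η ζ := by
  simp only [tensorForm, Matrix.neg_apply, mul_neg, Finset.sum_neg_distrib]

lemma tensorForm_single (A : Fin n → Fin n → Fin n → Fin n → ℝ) (i j k l : Fin n) :
    tensorForm A (Matrix.single i j 1) (Matrix.single k l 1) = A i j k l := by
  simp [tensorForm, Matrix.single_apply, ite_and]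

lemma tensorForm_comm {A : Fin n → Fin n → Fin n → Fin n → ℝ}
    (hA : ∀ i j k l, A i j k l = A k l i j) (η ζ : Matrix (Fin n) (Fin n) ℝ) :
    tensorForm A η ζ = tensorForm A ζ η := by
  calc tensorForm A η ζ = ∑ i, ∑ k, ∑ j, ∑ l, A i j k l * η i j * ζ k l :=
        Finset.sum_congr rfl fun i _ => Finset.sum_comm
    _ = ∑ k, ∑ i, ∑ l, ∑ j, A i j k l * η i j * ζ k l := by
        rw [Finset.sum_comm]
        exact Finset.sum_congr rfl fun k _ => Finset.sum_congr rfl fun i _ => Finset.sum_comm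
    _ = tensorForm A ζ η := by
        refine Finset.sum_congr rfl fun k _ => Finset.sum_comm.trans
          (Finset.sum_congr rfl fun l _ => Finset.sum_congr rfl fun i _ =>
            Finset.sum_congr rfl fun j _ => ?_)
        rw [hA i j k l]
        ring

lemma tensorForm_transpose_left {A : Fin n → Fin n → Fin n → Fin n → ℝ}
    (hA : ∀ i j k l, A i j k l = A j i k l) (η ζ : Matrix (Fin n) (Fin n) ℝ) :
    tensorForm A η.transpose ζ = tensorForm A η ζ := by
  rw [tensorForm, Finset.sum_comm]
  simp only [tensorForm, Matrix.transpose_apply]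
  refine Finset.sum_congr rfl fun i _ => Finset.sum_congr rfl fun j _ =>
    Finset.sum_congr rfl fun k _ => Finset.sum_congr rfl fun l _ => ?_
  rw [hA i j k l]

/-- A tensor with the elastic symmetries that is nonnegative on symmetric matrices is nonnegative
on all matrices, since it only sees the symmetric part. -/
lemma tensorForm_self_nonneg {A : Fin n → Fin n → Fin n → Fin n → ℝ}
    (h1 : ∀ i j k l, A i j k l = A j i k l) (h3 : ∀ i j k l, A i j k l = A k l i j)
    (hpos : ∀ η : Matrix (Fin n) (Fin n) ℝ, η.IsSymm → 0 ≤ tensorForm A η η)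
    (η : Matrix (Fin n) (Fin n) ℝ) : 0 ≤ tensorForm A η η := by
  have h := hpos (η + η.transpose) (Matrix.isSymm_add_transpose_self η)
  have e : ∀ ζ, tensorForm A ζ η.transpose = tensorForm A ζ η := fun ζ => by
    rw [tensorForm_comm h3, tensorForm_transpose_left h1, tensorForm_comm h3]
  rw [tensorForm_add_left, tensorForm_add_right, tensorForm_add_right,
    tensorForm_transpose_left h1, tensorForm_transpose_left h1, e] at h
  linarith

/-- Ellipticity bounds each component of the tensor, by polarization over the symmetric matrices
`e_{ij} + e_{ji}`. -/
lemma abs_le_of_tensorForm_le {A : Fin n → Fin n → Fin n → Fin n → ℝ} {c : ℝ} (hc : 0 ≤ c)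
    (h1 : ∀ i j k l, A i j k l = A j i k l) (h2 : ∀ i j k l, A i j k l = A i j l k)
    (h3 : ∀ i j k l, A i j k l = A k l i j)
    (hpos : ∀ η : Matrix (Fin n) (Fin n) ℝ, η.IsSymm → 0 ≤ tensorForm A η η)
    (hle : ∀ η : Matrix (Fin n) (Fin n) ℝ, η.IsSymm →
      tensorForm A η η ≤ c * ∑ i, ∑ j, η i j ^ 2) (i j k l : Fin n) :
    |A i j k l| ≤ c * (n * n) := by
  let S : Fin n → Fin n → Matrix (Fin n) (Fin n) ℝ :=
    fun i j => Matrix.single i j 1 + Matrix.single j i 1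
  have hS : ∀ i j, (S i j).IsSymm := fun i j => by
    simp [S, Matrix.IsSymm, Matrix.transpose_add, Matrix.transpose_single, add_comm]
  have hSb : ∀ i j a b, |S i j a b| ≤ 2 := fun i j a b => by
    simp only [S, Matrix.add_apply, Matrix.single_apply]
    split_ifs <;> norm_num
  have hmix : tensorForm A (S i j) (S k l) = 4 * A i j k l := by
    simp only [S, tensorForm_add_left, tensorForm_add_right, tensorForm_single]
    rw [← h1 i j k l, ← h2 i j k l, ← h1 i j l k, ← h2 i j k l]
    ring
  have hsq : ∀ η : Matrix (Fin n) (Fin n) ℝ, (∀ a b, |η a b| ≤ 4) →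
      c * ∑ i, ∑ j, η i j ^ 2 ≤ c * (n * n * 16) := fun η hη => by
    refine mul_le_mul_of_nonneg_left ?_ hc
    calc ∑ i, ∑ j, η i j ^ 2 ≤ ∑ _i : Fin n, ∑ _j : Fin n, (16 : ℝ) := by
          refine Finset.sum_le_sum fun a _ => Finset.sum_le_sum fun b _ => ?_
          have := abs_le.1 (hη a b)
          nlinarith
      _ = n * n * 16 := by simp [mul_assoc]
  have hp := (hS i j).add (hS k l)
  have hm := (hS i j).add (hS k l).neg
  have p1 := hpos _ hp
  have p2 := (hle _ hp).trans (hsq _ fun a b => (abs_add_le _ _).trans (by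
    linarith [hSb i j a b, hSb k l a b]))
  have m1 := hpos _ hm
  have m2 := (hle _ hm).trans (hsq _ fun a b => (abs_add_le _ _).trans (by
    rw [Matrix.neg_apply, abs_neg]
    linarith [hSb i j a b, hSb k l a b]))
  simp only [tensorForm_add_left, tensorForm_add_right, tensorForm_neg_left, tensorForm_neg_right,
    tensorForm_comm h3 (S k l) (S i j), hmix] at p1 p2 m1 m2
  rw [abs_le]
  constructor <;> linarith

variable {Ω : Set (Rn n)} {ν : ℝ} {B : Fin n → Fin n → Fin n → Fin n → Rn n → ℝ}

lemma IsEllipticTensor.ae_tensorForm_nonneg (hν : 0 < ν) (hB : IsEllipticTensor Ω ν B) :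
    ∀ᵐ x ∂(volume.restrict Ω), ∀ η, 0 ≤ tensorForm (fun i j k l => B i j k l x) η η := by
  filter_upwards [hB.symmetric, hB.elliptic] with x hs he
  refine tensorForm_self_nonneg (fun i j k l => (hs i j k l).1) (fun i j k l => (hs i j k l).2.2)
    fun η hη => le_trans ?_ (he η hη).1
  positivity

lemma IsEllipticTensor.ae_abs_le (hν : 0 < ν) (hB : IsEllipticTensor Ω ν B) (i j k l : Fin n) :
    ∀ᵐ x ∂(volume.restrict Ω), ‖B i j k l x‖ ≤ 1 / ν * (n * n) := by
  filter_upwards [hB.symmetric, hB.elliptic, hB.ae_tensorForm_nonneg hν] with x hs he hp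
  exact abs_le_of_tensorForm_le (A := fun i j k l => B i j k l x) (by positivity)
    (fun i j k l => (hs i j k l).1) (fun i j k l => (hs i j k l).2.1)
    (fun i j k l => (hs i j k l).2.2) (fun η _ => hp η) (fun η hη => (he η hη).2) i j k l

lemma IsEllipticTensor.memLp_top (hν : 0 < ν) (hB : IsEllipticTensor Ω ν B) (i j k l : Fin n) :
    MemLp (B i j k l) ∞ (volume.restrict Ω) :=
  memLp_top_of_bound (hB.aemeasurable i j k l).aestronglyMeasurable _ (hB.ae_abs_le hν i j k l)

/-! ### The viscous form on square integrable fields -/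

lemma viscousDensity_eq_tensorForm (v w : Fin n → L2Field Ω) (x : Rn n) :
    viscousDensity B v w x
      = tensorForm (fun i j k l => B i j k l x) (Matrix.of fun i k => w i x k)
          (Matrix.of fun j l => v j x l) := by
  simp only [viscousDensity, tensorForm, block, Matrix.mulVec, dotProduct, Matrix.of_apply,
    Finset.sum_mul]
  refine Finset.sum_congr rfl fun i _ => Finset.sum_comm.trans ?_
  refine Finset.sum_congr rfl fun k _ => Finset.sum_congr rfl fun j _ =>
    Finset.sum_congr rfl fun l _ => ?_
  ring

lemma viscousDensity_eq_sum (v w : Fin n → L2Field Ω) (x : Rn n) :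
    viscousDensity B v w x = ∑ i, ∑ k, ∑ j, ∑ l, (B i k j l x * v j x l) * w i x k := by
  rw [viscousDensity_eq_tensorForm]
  exact Finset.sum_congr rfl fun i _ => Finset.sum_congr rfl fun j _ =>
    Finset.sum_congr rfl fun k _ => Finset.sum_congr rfl fun l _ => by
      simp only [Matrix.of_apply]; ring

/-- The `l`-th coordinate of a vector field, as a continuous linear map into `L²(Ω)`. -/
noncomputable def coordL2 (Ω : Set (Rn n)) (l : Fin n) :
    L2Field Ω →L[ℝ] Lp ℝ 2 ((volume : Measure (Rn n)).restrict Ω) :=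
  (EuclideanSpace.proj l : Rn n →L[ℝ] ℝ).compLpL 2 _

lemma coeFn_coordL2 (l : Fin n) (v : L2Field Ω) :
    coordL2 Ω l v =ᵐ[volume.restrict Ω] fun x => v x l :=
  (EuclideanSpace.proj l : Rn n →L[ℝ] ℝ).coeFn_compLpL v

/-- The continuous bilinear form `(v, w) ↦ ∫_Ω b v_{jl} w_{ik}` for `b ∈ L^∞(Ω)`. -/
noncomputable def componentForm (b : Lp ℝ ∞ ((volume : Measure (Rn n)).restrict Ω))
    (i k j l : Fin n) :
    (Fin n → L2Field Ω) →L[ℝ] (Fin n → L2Field Ω) →L[ℝ] ℝ :=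
  ((ContinuousLinearMap.mul ℝ ℝ).lpPairing (volume.restrict Ω) 2 2).bilinearComp
    (((ContinuousLinearMap.mul ℝ ℝ).holderL (volume.restrict Ω) ∞ 2 2 b).comp
      ((coordL2 Ω l).comp (ContinuousLinearMap.proj j)))
    ((coordL2 Ω k).comp (ContinuousLinearMap.proj i))

lemma integrable_component {b : Rn n → ℝ} (hb : MemLp b ∞ (volume.restrict Ω))
    (k l : Fin n) (v w : L2Field Ω) :
    IntegrableOn (fun x => (b x * v x l) * w x k) Ω := by
  have hc : ∀ (m : Fin n) (z : L2Field Ω), MemLp (fun x => z x m) 2 (volume.restrict Ω) :=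
    fun m z => (Lp.memLp (coordL2 Ω m z)).ae_eq (coeFn_coordL2 m z)
  exact MemLp.integrable_mul (p := 2) (q := 2) ((hc l v).mul hb) (hc k w)

lemma componentForm_apply {b : Rn n → ℝ} (hb : MemLp b ∞ (volume.restrict Ω))
    (i k j l : Fin n) (v w : Fin n → L2Field Ω) :
    componentForm hb.toLp i k j l v w = ∫ x in Ω, (b x * v j x l) * w i x k := by
  rw [componentForm, ContinuousLinearMap.bilinearComp_apply,
    ContinuousLinearMap.lpPairing_eq_integral]
  refine integral_congr_ae ?_
  filter_upwards [(ContinuousLinearMap.mul ℝ ℝ).coeFn_holder (r := 2) hb.toLp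
    (coordL2 Ω l (v j)), hb.coeFn_toLp, coeFn_coordL2 l (v j), coeFn_coordL2 k (w i)]
    with x h1 h2 h3 h4
  simp only [ContinuousLinearMap.comp_apply, ContinuousLinearMap.proj_apply,
    ContinuousLinearMap.holderL_apply_apply, ContinuousLinearMap.mul_apply'] at *
  rw [h1, h2, h3, h4]

lemma integrableOn_viscousDensity (hB : ∀ i j k l, MemLp (B i j k l) ∞ (volume.restrict Ω))
    (v w : Fin n → L2Field Ω) : IntegrableOn (viscousDensity B v w) Ω := by
  rw [funext (viscousDensity_eq_sum v w)]
  exact integrable_finsetSum _ fun i _ => integrable_finsetSum _ fun k _ =>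
    integrable_finsetSum _ fun j _ => integrable_finsetSum _ fun l _ =>
      integrable_component (hB i k j l) k l (v j) (w i)

/-- The viscous form of a bounded tensor field, as a continuous bilinear form. -/
noncomputable def viscousFormL (hB : ∀ i j k l, MemLp (B i j k l) ∞ (volume.restrict Ω)) :
    (Fin n → L2Field Ω) →L[ℝ] (Fin n → L2Field Ω) →L[ℝ] ℝ :=
  ∑ i, ∑ k, ∑ j, ∑ l, componentForm (hB i k j l).toLp i k j l

lemma viscousFormL_apply (hB : ∀ i j k l, MemLp (B i j k l) ∞ (volume.restrict Ω))
    (v w : Fin n → L2Field Ω) : viscousFormL hB v w = viscousForm B v w := by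
  have hint := fun i k j l => integrable_component (hB i k j l) k l (v j) (w i)
  simp only [viscousFormL, sum_apply, componentForm_apply, viscousForm,
    viscousDensity_eq_sum]
  rw [integral_finsetSum _ fun i _ => integrable_finsetSum _ fun k _ =>
    integrable_finsetSum _ fun j _ => integrable_finsetSum _ fun l _ => hint i k j l]
  refine Finset.sum_congr rfl fun i _ => ?_
  rw [integral_finsetSum _ fun k _ =>
    integrable_finsetSum _ fun j _ => integrable_finsetSum _ fun l _ => hint i k j l]
  refine Finset.sum_congr rfl fun k _ => ?_
  rw [integral_finsetSum _ fun j _ => integrable_finsetSum _ fun l _ => hint i k j l]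
  refine Finset.sum_congr rfl fun j _ => ?_
  rw [integral_finsetSum _ fun l _ => hint i k j l]

lemma IsEllipticTensor.viscousForm_comm (hB : IsEllipticTensor Ω ν B) (v w : Fin n → L2Field Ω) :
    viscousForm B v w = viscousForm B w v := by
  refine integral_congr_ae ?_
  filter_upwards [hB.symmetric] with x hx
  rw [viscousDensity_eq_tensorForm, viscousDensity_eq_tensorForm]
  exact tensorForm_comm (fun i j k l => (hx i j k l).2.2) _ _

lemma IsEllipticTensor.viscousForm_self_nonneg (hν : 0 < ν) (hB : IsEllipticTensor Ω ν B)
    (v : Fin n → L2Field Ω) : 0 ≤ viscousForm B v v := by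
  refine integral_nonneg_of_ae ?_
  filter_upwards [hB.ae_tensorForm_nonneg hν] with x hx
  rw [viscousDensity_eq_tensorForm]
  exact hx _

/-- The gradient `u ↦ (∂_j u)_j` on `H₀¹(Ω; ℝⁿ)`, as a continuous linear map. -/
noncomputable def weakGradient (Ω : Set (Rn n)) : H01 Ω →L[ℝ] (Fin n → L2Field Ω) :=
  ContinuousLinearMap.pi fun j =>
    (PiLp.proj (𝕜 := ℝ) 2 (fun _ : Fin n => L2Field Ω) j).comp
      ((WithLp.sndL 2 ℝ (L2Field Ω) (PiLp 2 fun _ : Fin n => L2Field Ω)).comp (H01 Ω).subtypeL)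

lemma weakGradient_apply (u : H01 Ω) (j : Fin n) : weakGradient Ω u j = weakPartial j u := rfl

end FracVisc

/-! ### Fractional integrals of gradients -/

namespace FracVisc

variable {n : ℕ} {Ω : Set (Rn n)} {T : ℝ}

lemma memLp_weakGradient (u : TimeL2 T (H01 Ω)) :
    MemLp (fun r => weakGradient Ω (u r)) 2 (volume.restrict (Ioo 0 T)) :=
  (weakGradient Ω).comp_memLp' (Lp.memLp u)

lemma ae_intervalIntegrable_weakPartial {γ : ℝ} (hγ : γ < 1) (u : TimeL2 T (H01 Ω)) :
    ∀ᵐ s ∂(volume.restrict (Ioo 0 T)), ∀ j : Fin n,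
      IntervalIntegrable (fun r => (s - r) ^ (-γ) • weakPartial j (u r)) volume 0 s :=
  ae_all_iff.2 fun j => ae_intervalIntegrable_rpow_smul hγ
    (((memLp_weakGradient u).eval j).integrable (by norm_num))

/-- The coordinates of the fractional integral of a function with values in a finite product are
the fractional integrals of the coordinates, as soon as these converge absolutely. -/
lemma fracIntegral_pi {ι H : Type*} [Fintype ι] [NormedAddCommGroup H] [NormedSpace ℝ H]
    [CompleteSpace H] {β s : ℝ} (hs : 0 ≤ s) {f : ℝ → ι → H}
    (hf : ∀ j, IntervalIntegrable (fun r => (s - r) ^ (β - 1) • f r j) volume 0 s) :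
    fracIntegral β f s = fun j => fracIntegral β (fun r => f r j) s := by
  funext j
  simp only [fracIntegral, Pi.smul_apply, intervalIntegral.integral_of_le hs]
  congr 1
  exact eval_integral (f := fun r => (s - r) ^ (β - 1) • f r) (fun i => (hf i).1) j

end FracVisc

theorem mainTheorem6 {n : ℕ} (Ω : Set (Rn n)) (hΩ : IsOpen Ω)
    (T : ℝ) (hT : 0 < T) (α : ℝ) (hα : α ∈ Ioo (0 : ℝ) 1) (ν : ℝ) (hν : 0 < ν)
    (B : Fin n → Fin n → Fin n → Fin n → Rn n → ℝ) (hB : IsEllipticTensor Ω ν B)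
    (u : TimeL2 T (H01 Ω)) :
    (∀ᵐ s ∂(volume.restrict (Ioo 0 T)), ∀ j : Fin n,
      IntervalIntegrable (fun r => (s - r) ^ ((1 - α) - 1) • weakPartial j (u r)) volume 0 s) ∧
    (∀ᵐ s ∂(volume.restrict (Ioo 0 T)),
      IntegrableOn (viscousDensity B
        (fun j => fracIntegral (1 - α) (fun r => weakPartial j (u r)) s)
        (fun i => weakPartial i (u s))) Ω volume) ∧
    ∀ t ∈ Icc 0 T,
      IntervalIntegrable (fun s => viscousForm B
        (fun j => fracIntegral (1 - α) (fun r => weakPartial j (u r)) s)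
        (fun i => weakPartial i (u s))) volume 0 t ∧
      0 ≤ ∫ s in (0 : ℝ)..t, viscousForm B
        (fun j => fracIntegral (1 - α) (fun r => weakPartial j (u r)) s)
        (fun i => weakPartial i (u s)) := by
  have hexp : (1 - α) - 1 = -α := by ring
  have hbdd := fun i j k l => hB.memLp_top hν i j k l
  have hconv := ae_intervalIntegrable_weakPartial hα.2 u
  -- the density is integrable for any two families of fields in `L²`, hence for every `s`
  refine ⟨by simpa only [hexp] using hconv,
    Filter.Eventually.of_forall fun s => integrableOn_viscousDensity hbdd _ _, fun t ht => ?_⟩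
  have hsub : Ioo 0 t ⊆ Ioo 0 T := Ioo_subset_Ioo_right ht.2
  obtain ⟨hint, hpos⟩ := bilin_fracIntegral_nonneg hα ht.1 (viscousFormL hbdd)
    (fun v w => by rw [viscousFormL_apply, viscousFormL_apply, hB.viscousForm_comm])
    (fun v => by rw [viscousFormL_apply]; exact hB.viscousForm_self_nonneg hν v)
    ((memLp_weakGradient u).mono_measure (Measure.restrict_mono hsub le_rfl))
  -- the fractional integral of the gradient is the family of fractional integrals of the partial
  -- derivatives only where the latter converge, that is for almost every `s`
  have hae : (fun s => viscousFormL hbdd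
        (fracIntegral (1 - α) (fun r => weakGradient Ω (u r)) s) (weakGradient Ω (u s)))
      =ᵐ[volume.restrict (uIoc 0 t)] fun s => viscousForm B
        (fun j => fracIntegral (1 - α) (fun r => weakPartial j (u r)) s)
        (fun i => weakPartial i (u s)) := by
    rw [uIoc_of_le ht.1, ← restrict_Ioo_eq_restrict_Ioc]
    filter_upwards [ae_restrict_of_ae_restrict_of_subset hsub hconv,
      ae_restrict_mem measurableSet_Ioo] with s hs hst
    rw [viscousFormL_apply, fracIntegral_pi hst.1.le
      (by simpa only [hexp, weakGradient_apply] using hs)]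
    rfl
  refine ⟨hint.congr_ae hae, ?_⟩
  rwa [intervalIntegral.integral_congr_ae_restrict hae] at hpos
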